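/- **Theorem 5.5.** Let $\xi_1',\dots,\xi_n'$ be random vectors in $\mathbb{R}^d$, $d\ge 1$, defined on a common probability space, with partial sums $S_k'=\xi_1'+\dots+\xi_k'$, and consider the following three cases. * Case $A_{n-1}$ (bridges): $(\xi_1',\dots,\xi_n')\stackrel{d}{=}(\xi_{\sigma(1)}',\dots,\xi_{\sigma(n)}')$ for every permutation $\sigma$ of $\{1,\dots,n\}$, and $S_n'=0$ a.s. Put $H_{n,d}'=\mathrm{Conv}(S_1',\dots,S_{n-1}')$ and $u=1$. * Case $B_n$ (symmetric walks): $(\xi_1',\dots,\xi_n')\stackrel{d}{=}(\varepsilon_1\xi_{\sigma(1)}',\dots,\varepsilon_n\xi_{\sigma(n)}')$ for every permutation $\sigma$ and all signs $\varepsilon_1,\dots,\varepsilon_n\in\{-1,1\}$. Put $H_{n,d}'=\mathrm{Conv}(S_1',\dots,S_n')$ and $u=\frac12$. * Case $D_n$: $(\xi_1',\dots,\xi_n')\stackrel{d}{=}(\varepsilon_1\xi_{\sigma(1)}',\dots,\varepsilon_n\xi_{\sigma(n)}')$ for every permutation $\sigma$ and all signs $\varepsilon_1,\dots,\varepsilon_n\in\{-1,1\}$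 with $\varepsilon_1\cdots\varepsilon_n=1$. Put $H_{n,d}'=\mathrm{Conv}(S_1',\dots,S_{n-1}',S_n',S_{n-1}'-\xi_n')$ and $u=\frac12$. No general position assumption is made, so that, for example, the simple random walk on $\mathbb{Z}^d$ is covered by case $B_n$. Then for every $\varepsilon\in(0,\frac12)$ there exist $\delta=\delta(\varepsilon)\in(0,1)$ and $C=C(\varepsilon)>0$, depending on $\varepsilon$ only, such that in each of the three cases, for all $d\ge 1$, all $n>\mathrm{e}^{d/(u-\varepsilon)}$ and all such $\xi_1',\dots,\xi_n'$, $$ \mathbb{P}[0\in H_{n,d}']\ \ge\ 1-C\,n^{-\delta}. $$ -/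

import Mathlib

open MeasureTheory ProbabilityTheory

/-- The three symmetry types of increments: `A` (random walk bridges, Coxeter group `A_{n-1}`),
`B` (symmetric random walks, Coxeter group `B_n`) and `D` (Coxeter group `D_n`). -/
inductive WalkType
  | A
  | B
  | D

/-- The constant `u`: it is `1` in the `A_{n-1}` case and `1/2` in the `B_n` and `D_n` cases. -/
noncomputable def WalkType.u : WalkType → ℝ
  | .A => 1
  | .B => 1 / 2
  | .D => 1 / 2

/-- The `k`-th partial sum `S_k = x_1 + ⋯ + x_k` of the tuple `x_1, …, x_n` (the entry `x_j` is
`x i` with `(i : ℕ) = j - 1`). -/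
def partialSum {E : Type*} [AddCommGroup E] {n : ℕ} (x : Fin n → E) (k : ℕ) : E :=
  ∑ i ∈ Finset.univ.filter (fun i : Fin n => (i : ℕ) < k), x i

/-- The points whose convex hull is considered:
`S_1, …, S_{n-1}` in type `A`; `S_1, …, S_n` in type `B`;
`S_1, …, S_n, S_n^*` with `S_n^* = S_{n-1} - x_n` in type `D`. -/
def hullPoints {E : Type*} [AddCommGroup E] {n : ℕ} : WalkType → (Fin n → E) → Set E
  | .A, x => {y | ∃ k, 1 ≤ k ∧ k + 1 ≤ n ∧ y = partialSum x k}
  | .B, x => {y | ∃ k, 1 ≤ k ∧ k ≤ n ∧ y = partialSum x k}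
  | .D, x => {y | ∃ k, 1 ≤ k ∧ k ≤ n ∧ y = partialSum x k} ∪
      {y | ∃ i : Fin n, (i : ℕ) + 1 = n ∧ y = partialSum x (n - 1) - x i}

/-- The tuple `(ξ_1, …, ξ_n)` has the same joint law as `(ε_1 ξ_{σ(1)}, …, ε_n ξ_{σ(n)})`. -/
def InvariantUnder {Ω : Type*} [MeasurableSpace Ω] (P : Measure Ω) {n d : ℕ}
    (ξ : Fin n → Ω → EuclideanSpace ℝ (Fin d)) (σ : Equiv.Perm (Fin n)) (ε : Fin n → ℤˣ) : Prop :=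
  IdentDistrib (fun ω i => ξ i ω) (fun ω i => ((ε i : ℤ) : ℝ) • ξ (σ i) ω) P P

/-- The assumptions on the increments of each type, without general position:
* `A`: the increments are exchangeable and sum up to `0` almost surely;
* `B`: the increments are symmetrically exchangeable, i.e. their joint law is invariant under all
  permutations and all changes of signs;
* `D`: the joint law of the increments is invariant under all permutations and all changes of an
  even number of signs. -/
def IsWalkOfType {Ω : Type*} [MeasurableSpace Ω] (P : Measure Ω) {n d : ℕ}
    (ξ : Fin n → Ω → EuclideanSpace ℝ (Fin d)) : WalkType → Prop
  | .A => (∀ σ, InvariantUnder P ξ σ 1) ∧ ∀ᵐ ω ∂P, partialSum (fun i => ξ i ω) n = 0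
  | .B => ∀ σ ε, InvariantUnder P ξ σ ε
  | .D => ∀ σ ε, ∏ i, ε i = 1 → InvariantUnder P ξ σ ε

/-! By Abel summation, a nonzero relation `∑ c i • y i = 0` with `c 0 ≥ c 1 ≥ ⋯ ≥ 0` puts 0 in the
hull of the partial sums; for bridges a nonconstant antitone `c` is enough. By symmetry, the
probability of missing 0 is an average over the group of (signed) permutations, so it is at most the
share of rearrangements without such a relation. This share is bounded for every fixed tuple, so
general position plays no role.

The bound is an induction on the length: a vector `a` is inserted into a rearrangement `z`. If
adding `a` to one entry of `z` leaves a relation, both slots next to that entry are good. Hence bad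
slots outnumber bad merges by at most one, and only when no slot is good
(`sum_indicatorNat_not_le_of_adjacent`). A relation of `z` modulo `a` always yields a good slot:
lift it and sort the new coefficient in. So `badCountA_cons_le` and `badCountB_cons_le` bound the
count by merged tuples in dimension `D` plus a quotient tuple in dimension `D - 1` (plus `x` itself
in type B). The weight `s⁻¹ ^ D` turns the lost dimension into a factor `s`, whence the products of
`k + s` and `2k + 1 + s` in `badCountA_le` and `badCountB_le`.

Dividing by the group order leaves `s⁻¹ ^ d * ∏ (1 - u (1 - s) / (k + 1))`, with one more `s⁻¹` for
bridges. With `s = 1 - ε / 2` this is a negative power of `n` as soon as `d < (u - ε) log n`. Type D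
reduces to B: its hull contains the B hull and ignores the sign of the last increment. -/

/-! ### Chamber relations and sorted insertion -/

/-- There is a nonzero relation among the `y i` with coefficients in the closed Weyl chamber
`c 0 ≥ c 1 ≥ ⋯ ≥ 0` of type `B`. -/
def HasChamberRelB {E : Type*} [AddCommGroup E] [Module ℝ E] {n : ℕ} (y : Fin n → E) : Prop :=
  ∃ c : Fin n → ℝ, Antitone c ∧ (∀ i, 0 ≤ c i) ∧ (∃ i, c i ≠ 0) ∧ ∑ i, c i • y i = 0

/-- There is a nonconstant relation among the `y i` with coefficients in the closed Weyl chamber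
`c 0 ≥ c 1 ≥ ⋯` of type `A`. -/
def HasChamberRelA {E : Type*} [AddCommGroup E] [Module ℝ E] {n : ℕ} (y : Fin n → E) : Prop :=
  ∃ c : Fin n → ℝ, Antitone c ∧ (∃ i j, c i ≠ c j) ∧ ∑ i, c i • y i = 0

/-- The successors of `W` lie in `A`, and the left neighbour of the smallest one is an extra
element. -/
lemma card_add_one_le_of_adjacent {n : ℕ} (A : Finset (Fin (n + 1))) (W : Finset (Fin n))
    (hW : ∀ j ∈ W, j.castSucc ∈ A ∧ j.succ ∈ A) (hA : A.Nonempty) : W.card + 1 ≤ A.card := by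
  classical
  rcases W.eq_empty_or_nonempty with rfl | hne
  · simpa using hA
  · have hmem := W.min'_mem hne
    have hnot : (W.min' hne).castSucc ∉ W.map (Fin.succEmb n) := by
      intro h
      obtain ⟨j, hj, hjm⟩ := Finset.mem_map.1 h
      have h1 := W.min'_le j hj
      have h2 : (j : ℕ) + 1 = (W.min' hne : Fin n) := by simpa using congrArg Fin.val hjm
      have h3 : ((W.min' hne : Fin n) : ℕ) ≤ j := h1
      omega
    have hsub : insert (W.min' hne).castSucc (W.map (Fin.succEmb n)) ⊆ A := by
      intro a ha
      rcases Finset.mem_insert.1 ha with rfl | ha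
      · exact (hW _ hmem).1
      · obtain ⟨j, hj, rfl⟩ := Finset.mem_map.1 ha
        exact (hW j hj).2
    have := Finset.card_le_card hsub
    rwa [Finset.card_insert_of_notMem hnot, Finset.card_map] at this

lemma exists_antitone_insertNth {n : ℕ} (c : Fin n → ℝ) (hc : Antitone c) (t : ℝ) :
    ∃ p : Fin (n + 1), Antitone (p.insertNth t c : Fin (n + 1) → ℝ) := by
  classical
  have hex : ∃ k, ∀ i : Fin n, k ≤ (i : ℕ) → c i ≤ t :=
    ⟨n, fun i hi => absurd i.isLt (not_lt.2 hi)⟩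
  have hle : Nat.find hex ≤ n := Nat.find_min' hex fun i hi => absurd i.isLt (not_lt.2 hi)
  have hbefore : ∀ i : Fin n, (i : ℕ) < Nat.find hex → t ≤ c i := by
    intro i hi
    obtain ⟨j, hij, hj⟩ : ∃ j : Fin n, (i : ℕ) ≤ j ∧ t < c j := by
      simpa using Nat.find_min hex hi
    exact hj.le.trans (hc hij)
  -- The slot is the first index from which all entries are at most `t`.
  refine ⟨⟨Nat.find hex, Nat.lt_succ_of_le hle⟩, ?_⟩
  set p : Fin (n + 1) := ⟨Nat.find hex, Nat.lt_succ_of_le hle⟩ with hp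
  intro i j hij
  cases i using Fin.succAboveCases p with
  | x =>
    cases j using Fin.succAboveCases p with
    | x => exact le_rfl
    | p k =>
      rw [Fin.insertNth_apply_succAbove, Fin.insertNth_apply_same]
      refine Nat.find_spec hex k ?_
      have := Fin.lt_succAbove_iff_le_castSucc p k |>.1
        (lt_of_le_of_ne hij (Fin.succAbove_ne p k).symm)
      exact this
  | p l =>
    cases j using Fin.succAboveCases p with
    | x =>
      rw [Fin.insertNth_apply_succAbove, Fin.insertNth_apply_same]
      refine hbefore l ?_
      exact Fin.succAbove_lt_iff_castSucc_lt p l |>.1 (lt_of_le_of_ne hij (Fin.succAbove_ne p l))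
    | p k =>
      rw [Fin.insertNth_apply_succAbove, Fin.insertNth_apply_succAbove]
      exact hc (Fin.succAbove_le_succAbove_iff.1 hij)

/-! ### Passing relations from length `n` to length `n + 1` -/

section relations

variable {E : Type*} [AddCommGroup E] [Module ℝ E] {n : ℕ}

lemma sum_insertNth_smul (p : Fin (n + 1)) (t : ℝ) (c : Fin n → ℝ) (a : E) (z : Fin n → E) :
    ∑ i, (p.insertNth t c : Fin (n + 1) → ℝ) i • (p.insertNth a z : Fin (n + 1) → E) i =
      t • a + ∑ i, c i • z i := by
  rw [Fin.sum_univ_succAbove _ p]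
  simp

lemma sum_smul_add_single (c : Fin n → ℝ) (z : Fin n → E) (j : Fin n) (a : E) :
    ∑ i, c i • (z + Pi.single j a : Fin n → E) i = c j • a + ∑ i, c i • z i := by
  simp only [Pi.add_apply, smul_add, Finset.sum_add_distrib]
  rw [add_comm]
  congr 1
  rw [Finset.sum_eq_single j] <;> simp +contextual

lemma insertNth_eq_comp_predAbove (c : Fin n → ℝ) (j : Fin n) (p : Fin (n + 1))
    (hp : p = j.castSucc ∨ p = j.succ) :
    (p.insertNth (c j) c : Fin (n + 1) → ℝ) = c ∘ j.predAbove := by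
  rw [Fin.insertNth_eq_iff]
  rcases hp with rfl | rfl
  · refine ⟨by simp, ?_⟩
    ext i
    simp [Fin.removeNth]
  · refine ⟨by simp, ?_⟩
    ext i
    have : j.predAbove (j.succ.succAbove i) = i := by
      rcases le_or_gt i j with h | h
      · rw [Fin.succAbove_succ_of_le _ _ h, Fin.predAbove_castSucc_of_le _ _ h]
      · rw [Fin.succAbove_succ_of_lt _ _ h, Fin.predAbove_succ_of_le _ _ h.le]
    simp [Fin.removeNth, this]

lemma antitone_insertNth_self {c : Fin n → ℝ} (hc : Antitone c) (j : Fin n) (p : Fin (n + 1))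
    (hp : p = j.castSucc ∨ p = j.succ) : Antitone (p.insertNth (c j) c : Fin (n + 1) → ℝ) := by
  rw [insertNth_eq_comp_predAbove c j p hp]
  exact hc.comp_monotone (Fin.predAbove_right_monotone j)

/-- A relation of the merged tuple is one in which `a` and `z j` share the coefficient `c j`. It
lies on a wall, so it belongs to the chambers on both sides. -/
lemma HasChamberRelB.insertNth_of_add_single {z : Fin n → E} {j : Fin n} {a : E}
    (h : HasChamberRelB (z + Pi.single j a)) {p : Fin (n + 1)}
    (hp : p = j.castSucc ∨ p = j.succ) : HasChamberRelB (p.insertNth a z : Fin (n + 1) → E) := by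
  obtain ⟨c, hc, h0, ⟨i, hi⟩, hs⟩ := h
  refine ⟨p.insertNth (c j) c, antitone_insertNth_self hc j p hp, ?_, ⟨p.succAbove i, by simpa⟩, ?_⟩
  · rw [Fin.forall_iff_succAbove p]
    simpa using ⟨h0 j, h0⟩
  · rw [sum_insertNth_smul, ← sum_smul_add_single, hs]

lemma HasChamberRelA.insertNth_of_add_single {z : Fin n → E} {j : Fin n} {a : E}
    (h : HasChamberRelA (z + Pi.single j a)) {p : Fin (n + 1)}
    (hp : p = j.castSucc ∨ p = j.succ) : HasChamberRelA (p.insertNth a z : Fin (n + 1) → E) := by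
  obtain ⟨c, hc, ⟨i, i', hi⟩, hs⟩ := h
  refine ⟨p.insertNth (c j) c, antitone_insertNth_self hc j p hp,
    ⟨p.succAbove i, p.succAbove i', by simpa⟩, ?_⟩
  rw [sum_insertNth_smul, ← sum_smul_add_single, hs]

lemma HasChamberRelB.insertNth_last {z : Fin n → E} (h : HasChamberRelB z) (a : E) :
    HasChamberRelB ((Fin.last n).insertNth a z : Fin (n + 1) → E) := by
  obtain ⟨c, hc, h0, ⟨i, hi⟩, hs⟩ := h
  refine ⟨(Fin.last n).insertNth 0 c, ?_, ?_, ⟨(Fin.last n).succAbove i, by simpa⟩, ?_⟩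
  · intro i j hij
    cases j using Fin.succAboveCases (Fin.last n) with
    | x =>
      rw [Fin.insertNth_apply_same]
      revert i
      rw [Fin.forall_iff_succAbove (Fin.last n)]
      simpa using fun i _ => h0 i
    | p k =>
      cases i using Fin.succAboveCases (Fin.last n) with
      | x => exact absurd hij (by simp [Fin.succAbove_last])
      | p l =>
        rw [Fin.insertNth_apply_succAbove, Fin.insertNth_apply_succAbove]
        exact hc (Fin.succAbove_le_succAbove_iff.1 hij)
  · rw [Fin.forall_iff_succAbove (Fin.last n)]
    simpa using h0
  · rw [sum_insertNth_smul, hs]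
    simp

/-- A relation modulo `a` lifts to a relation for some signed insertion of `a`. -/
lemma exists_sum_eq_smul_of_quotient (c : Fin n → ℝ) (z : Fin n → E) (a : E)
    (h : ∑ i, c i • (Submodule.mkQ (Submodule.span ℝ {a})) (z i) = 0) :
    ∃ r : ℝ, r • a + ∑ i, c i • z i = 0 := by
  have h1 : Submodule.mkQ (Submodule.span ℝ {a}) (∑ i, c i • z i) = 0 := by simpa using h
  rw [Submodule.mkQ_apply, Submodule.Quotient.mk_eq_zero, Submodule.mem_span_singleton] at h1
  obtain ⟨r, hr⟩ := h1
  exact ⟨-r, by rw [← hr]; simp⟩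

lemma HasChamberRelA.exists_insertNth {z : Fin n → E} {a : E}
    (h : HasChamberRelA fun i => (Submodule.mkQ (Submodule.span ℝ {a})) (z i)) :
    ∃ p : Fin (n + 1), HasChamberRelA (p.insertNth a z : Fin (n + 1) → E) := by
  obtain ⟨c, hc, ⟨i, i', hi⟩, hs⟩ := h
  obtain ⟨r, hr⟩ := exists_sum_eq_smul_of_quotient c z a hs
  obtain ⟨p, hp⟩ := exists_antitone_insertNth c hc r
  exact ⟨p, _, hp, ⟨p.succAbove i, p.succAbove i', by simpa⟩, by rw [sum_insertNth_smul, hr]⟩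

/-- The lifted coefficient of `a` may be negative: its modulus is sorted into `c`, its sign goes to
`η`. -/
lemma HasChamberRelB.exists_insertNth {z : Fin n → E} {a : E}
    (h : HasChamberRelB fun i => (Submodule.mkQ (Submodule.span ℝ {a})) (z i)) :
    ∃ (η : ℤˣ) (p : Fin (n + 1)),
      HasChamberRelB (p.insertNth (((η : ℤ) : ℝ) • a) z : Fin (n + 1) → E) := by
  obtain ⟨c, hc, h0, ⟨i, hi⟩, hs⟩ := h
  obtain ⟨r, hr⟩ := exists_sum_eq_smul_of_quotient c z a hs
  obtain ⟨p, hp⟩ := exists_antitone_insertNth c hc |r|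
  obtain ⟨η, hη⟩ : ∃ η : ℤˣ, |r| * ((η : ℤ) : ℝ) = r := by
    rcases abs_choice r with h | h
    · exact ⟨1, by simp [h]⟩
    · exact ⟨-1, by simp [h]⟩
  refine ⟨η, p, _, hp, ?_, ⟨p.succAbove i, by simpa⟩, ?_⟩
  · rw [Fin.forall_iff_succAbove p]
    simpa using h0
  · rw [sum_insertNth_smul, smul_smul, hη, hr]

lemma antitone_pi_single_zero (n : ℕ) : Antitone (Pi.single 0 1 : Fin (n + 1) → ℝ) := by
  intro i j hij
  rcases eq_or_ne j 0 with rfl | hj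
  · rw [Fin.le_zero_iff.1 hij]
  · rw [Pi.single_eq_of_ne hj]
    exact (Pi.single_nonneg.2 (zero_le_one' ℝ) : (0 : Fin (n + 1) → ℝ) ≤ _) i

lemma hasChamberRelB_insertNth_zero (z : Fin n → E) :
    HasChamberRelB ((0 : Fin (n + 1)).insertNth 0 z : Fin (n + 1) → E) := by
  refine ⟨Pi.single 0 1, antitone_pi_single_zero n,
    fun i => (Pi.single_nonneg.2 (zero_le_one' ℝ) : (0 : Fin (n + 1) → ℝ) ≤ _) i, ⟨0, by simp⟩, ?_⟩
  rw [Fin.sum_univ_succAbove _ 0]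
  simp

/-- The other entries must be nonempty in number, since otherwise every coefficient vector is
constant. -/
lemma hasChamberRelA_insertNth_zero (z : Fin (n + 1) → E) :
    HasChamberRelA ((0 : Fin (n + 2)).insertNth 0 z : Fin (n + 2) → E) := by
  refine ⟨Pi.single 0 1, antitone_pi_single_zero _, ⟨0, 1, by simp⟩, ?_⟩
  rw [Fin.sum_univ_succAbove _ 0]
  simp

end relations

/-! ### Abel summation -/

lemma sum_sub_smul_sum_range {E : Type*} [AddCommGroup E] [Module ℝ E] (f : ℕ → ℝ) (y : ℕ → E)
    (n : ℕ) : ∑ k ∈ Finset.range n, (f k - f (k + 1)) • ∑ i ∈ Finset.range (k + 1), y i =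
      ∑ i ∈ Finset.range n, (f i - f n) • y i := by
  induction n with
  | zero => simp
  | succ n ih =>
    rw [Finset.sum_range_succ, ih, Finset.smul_sum, Finset.sum_range_succ, ← add_assoc,
      ← Finset.sum_add_distrib, Finset.sum_range_succ]
    congr 1
    refine Finset.sum_congr rfl fun i _ => ?_
    rw [← add_smul]
    congr 1
    ring

lemma partialSum_eq_sum_range {E : Type*} [AddCommGroup E] {n : ℕ} (x : Fin n → E) (k : ℕ)
    (hk : k ≤ n) :
    partialSum x k = ∑ i ∈ Finset.range k, if h : i < n then x ⟨i, h⟩ else 0 := by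
  have h1 : partialSum x k = ∑ i : Fin n, if (i : ℕ) < k then x i else 0 := by
    rw [partialSum, Finset.sum_filter]
  have h2 := Fin.sum_univ_eq_sum_range
    (fun i => if i < k then (if h : i < n then x ⟨i, h⟩ else 0) else 0) n
  rw [h1]
  simp only [Fin.is_lt, dite_true, Fin.eta] at h2
  rw [h2, ← Finset.sum_filter]
  refine Finset.sum_congr ?_ fun _ _ => rfl
  ext i
  simp only [Finset.mem_filter, Finset.mem_range]
  omega

/-- A nonnegative combination of points of `s`, with positive total weight, that vanishes. -/
lemma zero_mem_convexHull_of_sum_eq_zero {E : Type*} [AddCommGroup E] [Module ℝ E] {s : Set E}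
    {ι : Type*} (t : Finset ι) (w : ι → ℝ) (z : ι → E) (hw : ∀ i ∈ t, 0 ≤ w i)
    (hpos : 0 < ∑ i ∈ t, w i) (hz : ∀ i ∈ t, w i ≠ 0 → z i ∈ s)
    (hs : ∑ i ∈ t, w i • z i = 0) : (0 : E) ∈ convexHull ℝ s := by
  classical
  have h := Finset.centerMass_mem_convexHull (s := s) (t.filter fun i => w i ≠ 0) (w := w) (z := z)
    (fun i hi => hw i (Finset.mem_filter.1 hi).1) (by rwa [Finset.sum_filter_ne_zero])
    (fun i hi => hz i (Finset.mem_filter.1 hi).1 (Finset.mem_filter.1 hi).2)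
  rwa [Finset.centerMass_filter_ne_zero, Finset.centerMass, hs, smul_zero] at h

lemma HasChamberRelB.zero_mem_convexHull {E : Type*} [AddCommGroup E] [Module ℝ E] {n : ℕ}
    {y : Fin n → E} (h : HasChamberRelB y) : (0 : E) ∈ convexHull ℝ (hullPoints .B y) := by
  obtain ⟨c, hc, h0, ⟨i, hi⟩, hs⟩ := h
  -- The default value 0 makes the weights telescope to `c 0`, which is positive.
  set f : ℕ → ℝ := fun k => if h : k < n then c ⟨k, h⟩ else 0 with hf
  set y' : ℕ → E := fun k => if h : k < n then y ⟨k, h⟩ else 0 with hy'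
  have hfn : f n = 0 := by simp [hf]
  refine zero_mem_convexHull_of_sum_eq_zero (Finset.range n) (fun k => f k - f (k + 1))
    (fun k => partialSum y (k + 1)) ?_ ?_ ?_ ?_
  · intro k hk
    have hk := Finset.mem_range.1 hk
    simp only [hf, hk, dite_true, sub_nonneg]
    split_ifs with h
    · exact hc (Fin.mk_le_mk.2 k.le_succ)
    · exact h0 _
  · rw [Finset.sum_range_sub', hfn, sub_zero]
    have hn : 0 < n := i.pos
    simp only [hf, hn, dite_true]
    exact ((h0 i).lt_of_ne' hi).trans_le (hc (Fin.mk_le_of_le_val (Nat.zero_le _)))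
  · intro k hk _
    exact ⟨k + 1, by omega, Finset.mem_range.1 hk, rfl⟩
  · have h1 : ∀ k ∈ Finset.range n, (f k - f (k + 1)) • partialSum y (k + 1) =
        (f k - f (k + 1)) • ∑ i ∈ Finset.range (k + 1), y' i := by
      intro k hk
      rw [partialSum_eq_sum_range _ _ (Finset.mem_range.1 hk)]
    rw [Finset.sum_congr rfl h1, sum_sub_smul_sum_range, hfn, ← hs,
      ← Fin.sum_univ_eq_sum_range (fun i => (f i - 0) • y' i)]
    simp [hf, hy']

lemma HasChamberRelA.zero_mem_convexHull {E : Type*} [AddCommGroup E] [Module ℝ E] {n : ℕ}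
    {y : Fin n → E} (h : HasChamberRelA y) (hy : partialSum y n = 0) :
    (0 : E) ∈ convexHull ℝ (hullPoints .A y) := by
  obtain ⟨c, hc, ⟨i, j, hij⟩, hs⟩ := h
  have hn : 0 < n := i.pos
  -- Extending `c` by its last value gives the full sum weight 0, so only the partial sums allowed
  -- in type A are used. The constant subtracted by Abel summation is harmless because the entries
  -- sum to 0.
  set f : ℕ → ℝ := fun k => c ⟨min k (n - 1), by omega⟩ with hf
  set y' : ℕ → E := fun k => if h : k < n then y ⟨k, h⟩ else 0 with hy'
  have hfc : ∀ i : Fin n, f i = c i := fun i => by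
    simp only [hf]
    congr
    exact min_eq_left (by omega)
  have hfa : Antitone f := fun k l hkl => hc (Fin.mk_le_mk.2 (by omega))
  have hlast : f (n - 1 + 1) = f (n - 1) := by
    simp only [hf]
    congr 2
    omega
  refine zero_mem_convexHull_of_sum_eq_zero (Finset.range n) (fun k => f k - f (k + 1))
    (fun k => partialSum y (k + 1)) ?_ ?_ ?_ ?_
  · exact fun k _ => sub_nonneg.2 (hfa k.le_succ)
  · rw [Finset.sum_range_sub', sub_pos]
    have hfi : ∀ i : Fin n, f n ≤ c i ∧ c i ≤ f 0 := fun i =>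
      ⟨hfc i ▸ hfa i.isLt.le, hfc i ▸ hfa (Nat.zero_le _)⟩
    by_contra hle
    exact hij (le_antisymm (by linarith [(hfi i).2, (hfi j).1]) (by linarith [(hfi j).2, (hfi i).1]))
  · intro k hk hne
    have hk := Finset.mem_range.1 hk
    refine ⟨k + 1, by omega, ?_, rfl⟩
    by_contra hlt
    obtain rfl : k = n - 1 := by omega
    exact hne (by rw [hlast, sub_self])
  · have h1 : ∀ k ∈ Finset.range n, (f k - f (k + 1)) • partialSum y (k + 1) =
        (f k - f (k + 1)) • ∑ i ∈ Finset.range (k + 1), y' i := by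
      intro k hk
      rw [partialSum_eq_sum_range _ _ (Finset.mem_range.1 hk)]
    have hy0 : ∑ i, y i = 0 := by
      rw [← hy, partialSum]
      simp
    rw [Finset.sum_congr rfl h1, sum_sub_smul_sum_range,
      ← Fin.sum_univ_eq_sum_range (fun i => (f i - f n) • y' i)]
    simp only [hfc, hy', Fin.is_lt, dite_true, Fin.eta, sub_smul, Finset.sum_sub_distrib, hs,
      ← Finset.smul_sum, hy0]
    simp

/-! ### Counting -/

open Classical in
/-- The indicator of a proposition. -/
noncomputable def indicatorNat (p : Prop) : ℕ := if p then 1 else 0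

lemma indicatorNat_of_true {p : Prop} (h : p) : indicatorNat p = 1 := if_pos h

lemma indicatorNat_of_false {p : Prop} (h : ¬p) : indicatorNat p = 0 := if_neg h

lemma indicatorNat_le_one (p : Prop) : indicatorNat p ≤ 1 := by
  rw [indicatorNat]
  split_ifs <;> simp

lemma sum_indicatorNat_not {ι : Type*} [Fintype ι] (P : ι → Prop) [DecidablePred P] :
    ∑ i, indicatorNat (¬P i) + (Finset.univ.filter P).card = Fintype.card ι := by
  rw [Finset.card_filter, ← Finset.sum_add_distrib, Fintype.card_eq_sum_ones]
  refine Finset.sum_congr rfl fun i _ => ?_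
  by_cases h : P i <;> simp [indicatorNat, h]

lemma sum_indicatorNat_not_le_of_adjacent {n : ℕ} (P : Fin (n + 1) → Prop) (Q : Fin n → Prop)
    (h : ∀ j, Q j → P j.castSucc ∧ P j.succ) :
    ∑ p, indicatorNat (¬P p) ≤ ∑ j, indicatorNat (¬Q j) + indicatorNat (¬∃ p, P p) := by
  classical
  have h1 := sum_indicatorNat_not P
  have h2 := sum_indicatorNat_not Q
  simp only [Fintype.card_fin] at h1 h2
  by_cases hP : ∃ p, P p
  · have := card_add_one_le_of_adjacent (Finset.univ.filter P) (Finset.univ.filter Q)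
      (fun j hj => by simpa using h j (by simpa using hj))
      (by obtain ⟨p, hp⟩ := hP; exact ⟨p, by simpa using hp⟩)
    omega
  · have hW : (Finset.univ.filter Q).card = 0 := by
      rw [Finset.card_eq_zero, Finset.filter_eq_empty_iff]
      exact fun j _ hj => hP ⟨_, (h j hj).1⟩
    rw [indicatorNat_of_true hP]
    omega

/-! ### Splitting sums over the group by the slot of one vector -/

section insertion

variable {n : ℕ}

/-- The permutation taking `p` to `0` and otherwise acting as `τ`. -/
def insertPerm (p : Fin (n + 1)) (τ : Equiv.Perm (Fin n)) : Equiv.Perm (Fin (n + 1)) :=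
  ((finSuccEquiv' p).trans (Equiv.optionCongr τ)).trans (finSuccEquiv n).symm

@[simp] lemma insertPerm_self (p : Fin (n + 1)) (τ : Equiv.Perm (Fin n)) :
    insertPerm p τ p = 0 := by
  simp [insertPerm]

@[simp] lemma insertPerm_succAbove (p : Fin (n + 1)) (τ : Equiv.Perm (Fin n)) (i : Fin n) :
    insertPerm p τ (p.succAbove i) = (τ i).succ := by
  simp [insertPerm]

lemma insertPerm_bijective :
    Function.Bijective fun q : Fin (n + 1) × Equiv.Perm (Fin n) => insertPerm q.1 q.2 := by
  rw [Fintype.bijective_iff_injective_and_card]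
  constructor
  · rintro ⟨p, τ⟩ ⟨p', τ'⟩ h
    simp only at h
    obtain rfl : p = p' := by
      apply (insertPerm p τ).injective
      rw [insertPerm_self, h, insertPerm_self]
    congr
    ext i
    have := DFunLike.congr_fun h (p.succAbove i)
    simpa using congrArg Fin.val this
  · simp [Fintype.card_perm, Nat.factorial_succ]

variable {E : Type*} [AddCommGroup E] [Module ℝ E]

/-- The tuple `(ε 1 • x (σ 1), …, ε n • x (σ n))`. -/
def signedRearrange (x : Fin n → E) (g : Equiv.Perm (Fin n) × (Fin n → ℤˣ)) : Fin n → E :=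
  fun i => ((g.2 i : ℤ) : ℝ) • x (g.1 i)

lemma comp_insertPerm {α : Type*} (a : α) (x : Fin n → α) (p : Fin (n + 1))
    (τ : Equiv.Perm (Fin n)) : (Fin.cons a x : Fin (n + 1) → α) ∘ insertPerm p τ = p.insertNth a (x ∘ τ) := by
  rw [Fin.eq_insertNth_iff]
  refine ⟨by simp, ?_⟩
  ext i
  simp [Fin.removeNth]

lemma signedRearrange_insertPerm (a : E) (x : Fin n → E) (p : Fin (n + 1)) (η : ℤˣ)
    (g : Equiv.Perm (Fin n) × (Fin n → ℤˣ)) :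
    signedRearrange (Fin.cons a x : Fin (n + 1) → E) (insertPerm p g.1, p.insertNth η g.2) =
      p.insertNth (((η : ℤ) : ℝ) • a) (signedRearrange x g) := by
  rw [Fin.eq_insertNth_iff]
  refine ⟨by simp [signedRearrange], ?_⟩
  ext i
  simp [Fin.removeNth, signedRearrange]

lemma sum_comp_perm_succ {α : Type*} (F : (Fin (n + 1) → α) → ℕ) (a : α) (x : Fin n → α) :
    ∑ σ : Equiv.Perm (Fin (n + 1)), F ((Fin.cons a x : Fin (n + 1) → α) ∘ σ) =
      ∑ τ : Equiv.Perm (Fin n), ∑ p : Fin (n + 1), F (p.insertNth a (x ∘ τ)) := by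
  rw [← insertPerm_bijective.sum_comp, Fintype.sum_prod_type_right]
  simp only [comp_insertPerm]

lemma sum_signedRearrange_succ (F : (Fin (n + 1) → E) → ℕ) (a : E) (x : Fin n → E) :
    ∑ g, F (signedRearrange (Fin.cons a x : Fin (n + 1) → E) g) =
      ∑ g, ∑ η : ℤˣ, ∑ p : Fin (n + 1),
        F (p.insertNth (((η : ℤ) : ℝ) • a) (signedRearrange x g)) := by
  rw [Fintype.sum_prod_type, ← insertPerm_bijective.sum_comp, Fintype.sum_prod_type]
  have h : ∀ (p : Fin (n + 1)) (τ : Equiv.Perm (Fin n)),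
      ∑ ε : Fin (n + 1) → ℤˣ,
        F (signedRearrange (Fin.cons a x : Fin (n + 1) → E) (insertPerm p τ, ε)) =
      ∑ ε : Fin n → ℤˣ, ∑ η : ℤˣ,
        F (p.insertNth (((η : ℤ) : ℝ) • a) (signedRearrange x (τ, ε))) := by
    intro p τ
    rw [← (Fin.insertNthEquiv (fun _ => ℤˣ) p).sum_comp, Fintype.sum_prod_type_right]
    refine Finset.sum_congr rfl fun ε _ => Finset.sum_congr rfl fun η _ => ?_
    rw [← signedRearrange_insertPerm]
    rfl
  simp only [h]
  rw [Finset.sum_comm, Fintype.sum_prod_type]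
  refine Finset.sum_congr rfl fun τ _ => ?_
  rw [Finset.sum_comm]
  refine Finset.sum_congr rfl fun ε _ => ?_
  rw [Finset.sum_comm]

lemma add_single_comp_perm {M : Type*} [AddCommGroup M] (x : Fin n → M) (l : Fin n) (a : M)
    (τ : Equiv.Perm (Fin n)) : (x + Pi.single (τ l) a : Fin n → M) ∘ τ = x ∘ τ + Pi.single l a := by
  ext i
  by_cases h : i = l
  · subst h; simp
  · have : τ i ≠ τ l := fun h' => h (τ.injective h')
    simp [h, this]

lemma signedRearrange_add_single (x : Fin n → E) (l : Fin n) (a : E)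
    (g : Equiv.Perm (Fin n) × (Fin n → ℤˣ)) :
    signedRearrange (x + Pi.single (g.1 l) a) g =
      signedRearrange x g + Pi.single l (((g.2 l : ℤ) : ℝ) • a) := by
  ext i
  by_cases h : i = l
  · subst h; simp [signedRearrange]
  · have : g.1 i ≠ g.1 l := fun h' => h (g.1.injective h')
    simp [signedRearrange, h, this]

lemma sum_add_single_comp_perm {M : Type*} [AddCommGroup M] (F : (Fin n → M) → ℕ) (a : M)
    (x : Fin n → M) :
    ∑ τ : Equiv.Perm (Fin n), ∑ j, F (x ∘ τ + Pi.single j a) =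
      ∑ l, ∑ τ : Equiv.Perm (Fin n), F ((x + Pi.single l a : Fin n → M) ∘ τ) := by
  rw [Finset.sum_comm (s := (Finset.univ : Finset (Fin n)))]
  refine Finset.sum_congr rfl fun τ _ => ?_
  conv_rhs => rw [← Equiv.sum_comp τ]
  simp only [add_single_comp_perm]

/-- Merging `a` into entry `j` after rearranging is merging it into entry `g.1 j` before, up to the
sign `g.2 j`, which the sum over `η` absorbs. -/
lemma sum_signedRearrange_add_single (F : (Fin n → E) → ℕ) (a : E) (x : Fin n → E) :
    ∑ g, ∑ η : ℤˣ, ∑ j, F (signedRearrange x g + Pi.single j (((η : ℤ) : ℝ) • a)) =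
      ∑ l, ∑ η : ℤˣ, ∑ g, F (signedRearrange (x + Pi.single l (((η : ℤ) : ℝ) • a)) g) := by
  have h : ∀ l : Fin n,
      ∑ η : ℤˣ, ∑ g, F (signedRearrange (x + Pi.single l (((η : ℤ) : ℝ) • a)) g) =
      ∑ g, ∑ η : ℤˣ, F (signedRearrange (x + Pi.single l (((η : ℤ) : ℝ) • a)) g) :=
    fun l => Finset.sum_comm
  simp only [h]
  rw [Finset.sum_comm (s := (Finset.univ : Finset (Fin n)))]
  refine Finset.sum_congr rfl fun g _ => ?_
  rw [Finset.sum_comm]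
  conv_rhs => rw [← Equiv.sum_comp g.1]
  refine Finset.sum_congr rfl fun j _ => ?_
  conv_lhs => rw [← Equiv.sum_comp (Equiv.mulLeft (g.2 j))]
  refine Finset.sum_congr rfl fun η _ => ?_
  rw [signedRearrange_add_single, smul_smul]
  simp

end insertion

/-! ### The recursion for the number of bad rearrangements -/

section bounds

variable {n : ℕ} {E : Type*} [AddCommGroup E] [Module ℝ E]

lemma sum_not_hasChamberRelA_insertNth_le (z : Fin n → E) (a : E) :
    ∑ p : Fin (n + 1), indicatorNat (¬HasChamberRelA (p.insertNth a z : Fin (n + 1) → E)) ≤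
      ∑ j, indicatorNat (¬HasChamberRelA (z + Pi.single j a)) + indicatorNat
        (¬HasChamberRelA fun i => (Submodule.mkQ (Submodule.span ℝ {a})) (z i)) := by
  have key := sum_indicatorNat_not_le_of_adjacent
    (fun p : Fin (n + 1) => HasChamberRelA (p.insertNth a z : Fin (n + 1) → E))
    (fun j : Fin n => HasChamberRelA (z + Pi.single j a))
    (fun j hj => ⟨hj.insertNth_of_add_single (p := j.castSucc) (.inl rfl),
      hj.insertNth_of_add_single (p := j.succ) (.inr rfl)⟩)
  refine key.trans (add_le_add le_rfl ?_)
  by_cases h : HasChamberRelA fun i => (Submodule.mkQ (Submodule.span ℝ {a})) (z i)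
  · rw [indicatorNat_of_false (not_not.2 h.exists_insertNth)]
    exact Nat.zero_le _
  · rw [indicatorNat_of_true h]
    exact indicatorNat_le_one _

lemma sum_not_hasChamberRelA_insertNth_zero_le (z : Fin (n + 1) → E) :
    ∑ p : Fin (n + 2), indicatorNat (¬HasChamberRelA (p.insertNth 0 z : Fin (n + 2) → E)) ≤
      ∑ j, indicatorNat (¬HasChamberRelA (z + Pi.single j 0)) := by
  refine (sum_indicatorNat_not_le_of_adjacent
    (fun p => HasChamberRelA (p.insertNth 0 z : Fin _ → E))
    (fun j => HasChamberRelA (z + Pi.single j 0)) ?_).trans ?_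
  · exact fun j hj => ⟨hj.insertNth_of_add_single (p := j.castSucc) (.inl rfl),
      hj.insertNth_of_add_single (p := j.succ) (.inr rfl)⟩
  · rw [indicatorNat_of_false (not_not.2 ⟨0, hasChamberRelA_insertNth_zero z⟩), add_zero]

lemma sum_not_hasChamberRelB_insertNth_le_aux (z : Fin n → E) (a : E) :
    ∑ η : ℤˣ, ∑ p : Fin (n + 1),
        indicatorNat (¬HasChamberRelB (p.insertNth (((η : ℤ) : ℝ) • a) z : Fin (n + 1) → E)) ≤
      ∑ η : ℤˣ, ∑ j, indicatorNat (¬HasChamberRelB (z + Pi.single j (((η : ℤ) : ℝ) • a))) +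
      ∑ η : ℤˣ, indicatorNat (¬∃ p : Fin (n + 1),
        HasChamberRelB (p.insertNth (((η : ℤ) : ℝ) • a) z : Fin (n + 1) → E)) := by
  rw [← Finset.sum_add_distrib]
  refine Finset.sum_le_sum fun η _ => ?_
  have key := sum_indicatorNat_not_le_of_adjacent
    (fun p : Fin (n + 1) =>
      HasChamberRelB (p.insertNth (((η : ℤ) : ℝ) • a) z : Fin (n + 1) → E))
    (fun j : Fin n => HasChamberRelB (z + Pi.single j (((η : ℤ) : ℝ) • a)))
    (fun j hj => ⟨hj.insertNth_of_add_single (p := j.castSucc) (.inl rfl),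
      hj.insertNth_of_add_single (p := j.succ) (.inr rfl)⟩)
  exact key

/-- Each sign can contribute one excess bad slot. A relation of `z` excludes both, by giving `a`
coefficient 0 in the last slot; a relation modulo `a` excludes at least one. -/
lemma sum_not_hasChamberRelB_insertNth_le (z : Fin n → E) (a : E) :
    ∑ η : ℤˣ, ∑ p : Fin (n + 1),
        indicatorNat (¬HasChamberRelB (p.insertNth (((η : ℤ) : ℝ) • a) z : Fin (n + 1) → E)) ≤
      ∑ η : ℤˣ, ∑ j, indicatorNat (¬HasChamberRelB (z + Pi.single j (((η : ℤ) : ℝ) • a))) +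
      indicatorNat (¬HasChamberRelB z) + indicatorNat
        (¬HasChamberRelB fun i => (Submodule.mkQ (Submodule.span ℝ {a})) (z i)) := by
  refine (sum_not_hasChamberRelB_insertNth_le_aux z a).trans ?_
  rw [add_assoc]
  refine Nat.add_le_add_left ?_ _
  set e : ℤˣ → ℕ := fun η => indicatorNat (¬∃ p : Fin (n + 1),
    HasChamberRelB (p.insertNth (((η : ℤ) : ℝ) • a) z : Fin (n + 1) → E)) with he
  have hsum : ∑ η, e η = e 1 + e (-1) := by
    rw [UnitsInt.univ, Finset.sum_pair (by decide)]
  rw [hsum]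
  have hle : ∀ η, e η ≤ 1 := fun η => indicatorNat_le_one _
  have h1 := hle 1
  have h2 := hle (-1)
  by_cases hz : HasChamberRelB z
  · have : ∀ η, e η = 0 := fun η => indicatorNat_of_false (not_not.2 ⟨_, hz.insertNth_last _⟩)
    simp [this]
  · rw [indicatorNat_of_true hz]
    by_cases hq : HasChamberRelB fun i => (Submodule.mkQ (Submodule.span ℝ {a})) (z i)
    · obtain ⟨η, hη⟩ := hq.exists_insertNth
      have h0 : e η = 0 := indicatorNat_of_false (not_not.2 hη)
      rcases Int.units_eq_one_or η with rfl | rfl <;> omega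
    · rw [indicatorNat_of_true hq]
      omega

lemma sum_not_hasChamberRelB_insertNth_zero_le (z : Fin n → E) :
    ∑ η : ℤˣ, ∑ p : Fin (n + 1), indicatorNat
        (¬HasChamberRelB (p.insertNth (((η : ℤ) : ℝ) • (0 : E)) z : Fin (n + 1) → E)) ≤
      ∑ η : ℤˣ, ∑ j, indicatorNat
        (¬HasChamberRelB (z + Pi.single j (((η : ℤ) : ℝ) • (0 : E)))) := by
  refine (sum_not_hasChamberRelB_insertNth_le_aux z 0).trans (le_of_eq ?_)
  rw [add_eq_left, Finset.sum_eq_zero]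
  refine fun η _ => indicatorNat_of_false (not_not.2 ⟨0, ?_⟩)
  rw [smul_zero]
  exact hasChamberRelB_insertNth_zero z

/-- The number of rearrangements of `x` without a relation in the type `A` chamber. -/
noncomputable def badCountA (x : Fin n → E) : ℕ :=
  ∑ σ : Equiv.Perm (Fin n), indicatorNat (¬HasChamberRelA (x ∘ σ))

/-- The number of signed rearrangements of `x` without a relation in the type `B` chamber. -/
noncomputable def badCountB (x : Fin n → E) : ℕ :=
  ∑ g, indicatorNat (¬HasChamberRelB (signedRearrange x g))

lemma badCountA_cons_le (x : Fin n → E) (a : E) :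
    badCountA (Fin.cons a x : Fin (n + 1) → E) ≤ ∑ l, badCountA (x + Pi.single l a) +
      badCountA fun i => (Submodule.mkQ (Submodule.span ℝ {a})) (x i) := by
  rw [badCountA, sum_comp_perm_succ (fun y => indicatorNat (¬HasChamberRelA y))]
  refine (Finset.sum_le_sum fun τ _ => sum_not_hasChamberRelA_insertNth_le _ _).trans (le_of_eq ?_)
  rw [Finset.sum_add_distrib, sum_add_single_comp_perm (fun y => indicatorNat (¬HasChamberRelA y))]
  rfl

lemma badCountA_cons_zero_le (x : Fin (n + 1) → E) :
    badCountA (Fin.cons 0 x : Fin (n + 2) → E) ≤ ∑ l, badCountA (x + Pi.single l (0 : E)) := by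
  rw [badCountA, sum_comp_perm_succ (fun y => indicatorNat (¬HasChamberRelA y))]
  refine (Finset.sum_le_sum fun τ _ => sum_not_hasChamberRelA_insertNth_zero_le _).trans
    (le_of_eq ?_)
  rw [sum_add_single_comp_perm (fun y => indicatorNat (¬HasChamberRelA y))]
  rfl

lemma signedRearrange_map {F : Type*} [AddCommGroup F] [Module ℝ F] (f : E →ₗ[ℝ] F)
    (x : Fin n → E) (g : Equiv.Perm (Fin n) × (Fin n → ℤˣ)) :
    signedRearrange (fun i => f (x i)) g = fun i => f (signedRearrange x g i) := by
  ext i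
  simp [signedRearrange]

lemma badCountB_cons_le (x : Fin n → E) (a : E) :
    badCountB (Fin.cons a x : Fin (n + 1) → E) ≤
      ∑ l, ∑ η : ℤˣ, badCountB (x + Pi.single l (((η : ℤ) : ℝ) • a)) + badCountB x +
      badCountB fun i => (Submodule.mkQ (Submodule.span ℝ {a})) (x i) := by
  rw [badCountB, sum_signedRearrange_succ (fun y => indicatorNat (¬HasChamberRelB y))]
  refine (Finset.sum_le_sum fun g _ => sum_not_hasChamberRelB_insertNth_le _ _).trans (le_of_eq ?_)
  rw [Finset.sum_add_distrib, Finset.sum_add_distrib,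
    sum_signedRearrange_add_single (fun y => indicatorNat (¬HasChamberRelB y))]
  simp only [badCountB, signedRearrange_map]

lemma badCountB_cons_zero_le (x : Fin n → E) :
    badCountB (Fin.cons 0 x : Fin (n + 1) → E) ≤
      ∑ l, ∑ η : ℤˣ, badCountB (x + Pi.single l (((η : ℤ) : ℝ) • (0 : E))) := by
  rw [badCountB, sum_signedRearrange_succ (fun y => indicatorNat (¬HasChamberRelB y))]
  refine (Finset.sum_le_sum fun g _ => sum_not_hasChamberRelB_insertNth_zero_le _).trans
    (le_of_eq ?_)
  rw [sum_signedRearrange_add_single (fun y => indicatorNat (¬HasChamberRelB y))]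
  rfl

end bounds

/-! ### Solving the recursion -/

lemma finrank_quotient_span_singleton_add_one {E : Type*} [AddCommGroup E] [Module ℝ E]
    [FiniteDimensional ℝ E] {a : E} (ha : a ≠ 0) :
    Module.finrank ℝ (E ⧸ Submodule.span ℝ {a}) + 1 = Module.finrank ℝ E := by
  rw [← Submodule.finrank_quotient_add_finrank (Submodule.span ℝ {a}), finrank_span_singleton ha]

theorem badCountB_le {s : ℝ} (hs : 0 < s) (hs1 : s ≤ 1) {n : ℕ} {E : Type*} [AddCommGroup E]
    [Module ℝ E] [FiniteDimensional ℝ E] (x : Fin n → E) :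
    (badCountB x : ℝ) ≤
      (s⁻¹) ^ Module.finrank ℝ E * ∏ k ∈ Finset.range n, (2 * (k : ℝ) + 1 + s) := by
  have hinv : 1 ≤ s⁻¹ := (one_le_inv₀ hs).2 hs1
  induction n generalizing E with
  | zero =>
    have h : badCountB x ≤ 1 := by
      refine (Finset.sum_le_sum fun g _ => indicatorNat_le_one _).trans ?_
      simp
    simp only [Finset.range_zero, Finset.prod_empty, mul_one]
    exact (by exact_mod_cast h : (badCountB x : ℝ) ≤ 1).trans (one_le_pow₀ hinv)
  | succ n ih =>
    obtain ⟨a, x, rfl⟩ : ∃ a y, x = Fin.cons a y := ⟨x 0, Fin.tail x, (Fin.cons_self_tail x).symm⟩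
    set Q := ∏ k ∈ Finset.range n, (2 * (k : ℝ) + 1 + s) with hQ
    have hQ0 : 0 ≤ Q := Finset.prod_nonneg fun k _ => by positivity
    rw [Finset.prod_range_succ, ← hQ]
    set D := Module.finrank ℝ E with hD
    have hwalls : ((∑ l, ∑ η : ℤˣ, badCountB (x + Pi.single l (((η : ℤ) : ℝ) • a)) : ℕ) : ℝ) ≤
        2 * n * (s⁻¹ ^ D * Q) := by
      push_cast
      refine (Finset.sum_le_sum fun l _ => Finset.sum_le_sum fun η _ => ih _).trans (le_of_eq ?_)
      simp
      ring
    -- For `a = 0` the quotient loses no dimension, but slot 0 is then always good, so no excess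
    -- term arises.
    by_cases ha : a = 0
    · subst ha
      have h := (Nat.cast_le (α := ℝ)).2 (badCountB_cons_zero_le x)
      have h0 : 0 ≤ s⁻¹ ^ D * Q := by positivity
      nlinarith [h.trans hwalls]
    · have h := (Nat.cast_le (α := ℝ)).2 (badCountB_cons_le x a)
      have hx := ih x
      have hq := ih fun i => (Submodule.mkQ (Submodule.span ℝ {a})) (x i)
      rw [Nat.cast_add, Nat.cast_add] at h
      have hpow : s⁻¹ ^ D * s = s⁻¹ ^ Module.finrank ℝ (E ⧸ Submodule.span ℝ {a}) := by
        rw [hD, ← finrank_quotient_span_singleton_add_one ha, pow_succ, mul_assoc,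
          inv_mul_cancel₀ hs.ne', mul_one]
      rw [← hpow] at hq
      nlinarith

lemma badCountA_le_one {n : ℕ} {E : Type*} [AddCommGroup E] [Module ℝ E] (x : Fin n → E)
    (hn : n ≤ 1) : (badCountA x : ℝ) ≤ 1 := by
  have h : badCountA x ≤ 1 := by
    refine (Finset.sum_le_sum fun g _ => indicatorNat_le_one _).trans ?_
    simpa [Fintype.card_perm] using Nat.factorial_le hn
  exact_mod_cast h

theorem badCountA_le {s : ℝ} (hs : 0 < s) (hs1 : s ≤ 1) {n : ℕ} {E : Type*} [AddCommGroup E]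
    [Module ℝ E] [FiniteDimensional ℝ E] (x : Fin n → E) :
    (badCountA x : ℝ) ≤
      (s⁻¹) ^ (Module.finrank ℝ E + 1) * ∏ k ∈ Finset.range n, ((k : ℝ) + s) := by
  have hinv : 1 ≤ s⁻¹ := (one_le_inv₀ hs).2 hs1
  induction n generalizing E with
  | zero =>
    simp only [Finset.range_zero, Finset.prod_empty, mul_one]
    exact (badCountA_le_one x zero_le_one).trans (one_le_pow₀ hinv)
  | succ n ih =>
    obtain ⟨a, x, rfl⟩ : ∃ a y, x = Fin.cons a y := ⟨x 0, Fin.tail x, (Fin.cons_self_tail x).symm⟩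
    set Q := ∏ k ∈ Finset.range n, ((k : ℝ) + s) with hQ
    have hQ0 : 0 ≤ Q := Finset.prod_nonneg fun k _ => by positivity
    rw [Finset.prod_range_succ, ← hQ]
    set D := Module.finrank ℝ E with hD
    have hwalls : ((∑ l, badCountA (x + Pi.single l a) : ℕ) : ℝ) ≤ n * (s⁻¹ ^ (D + 1) * Q) := by
      push_cast
      refine (Finset.sum_le_sum fun l _ => ih _).trans (le_of_eq ?_)
      simp [hD]
    by_cases ha : a = 0
    · subst ha
      -- A single zero vector has no nonconstant relation. The extra `s⁻¹` in the bound compensates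
      -- for the factor `s` here.
      rcases n with _ | n
      · have hs' : s⁻¹ ^ (D + 1) * s = s⁻¹ ^ D := by
          rw [pow_succ, mul_assoc, inv_mul_cancel₀ hs.ne', mul_one]
        simp only [hQ, Finset.range_zero, Finset.prod_empty, one_mul, Nat.cast_zero, zero_add, hs']
        exact (badCountA_le_one _ le_rfl).trans (one_le_pow₀ hinv)
      · have h := (Nat.cast_le (α := ℝ)).2 (badCountA_cons_zero_le x)
        have h0 : 0 ≤ s⁻¹ ^ (D + 1) * Q := by positivity
        nlinarith [h.trans hwalls]
    · have h := (Nat.cast_le (α := ℝ)).2 (badCountA_cons_le x a)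
      have hq := ih (fun i => (Submodule.mkQ (Submodule.span ℝ {a})) (x i))
      rw [Nat.cast_add] at h
      have hpow : s⁻¹ ^ (D + 1) * s =
          s⁻¹ ^ (Module.finrank ℝ (E ⧸ Submodule.span ℝ {a}) + 1) := by
        rw [hD, ← finrank_quotient_span_singleton_add_one ha, pow_succ, mul_assoc,
          inv_mul_cancel₀ hs.ne', mul_one]
      rw [← hpow] at hq
      nlinarith

/-! ### Measurability -/

section measurability

lemma convexHull_range_eq_image_stdSimplex {E ι : Type*} [AddCommGroup E] [Module ℝ E] [Fintype ι]
    (v : ι → E) :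
    convexHull ℝ (Set.range v) = (fun w : ι → ℝ => ∑ i, w i • v i) '' stdSimplex ℝ ι := by
  classical
  have h := (Fintype.linearCombination ℝ v).image_convexHull
    (Set.range fun i j : ι => if i = j then (1 : ℝ) else 0)
  rw [convexHull_basis_eq_stdSimplex, ← Set.range_comp] at h
  have hv : (Fintype.linearCombination ℝ v) ∘ (fun i j : ι => if i = j then (1 : ℝ) else 0) = v := by
    ext i
    simp [Fintype.linearCombination_apply]
  rw [hv] at h
  exact h.symm

/-- The set is the projection of a closed set of pairs (weights, point) along the compact simplex of
weights. -/
lemma isClosed_setOf_zero_mem_convexHull_range {X E ι : Type*} [TopologicalSpace X]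
    [AddCommGroup E] [Module ℝ E] [TopologicalSpace E] [ContinuousAdd E] [ContinuousSMul ℝ E]
    [T1Space E] [Fintype ι] (f : ι → X → E) (hf : ∀ i, Continuous (f i)) :
    IsClosed {x | (0 : E) ∈ convexHull ℝ (Set.range fun i => f i x)} := by
  have h : {x | (0 : E) ∈ convexHull ℝ (Set.range fun i => f i x)} =
      Prod.snd '' {q : stdSimplex ℝ ι × X | ∑ i, (q.1 : ι → ℝ) i • f i q.2 = 0} := by
    ext x
    rw [Set.mem_ofPred_eq, convexHull_range_eq_image_stdSimplex]
    constructor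
    · rintro ⟨w, hw, hs⟩
      exact ⟨(⟨w, hw⟩, x), hs, rfl⟩
    · rintro ⟨⟨⟨w, hw⟩, y⟩, hs, rfl⟩
      exact ⟨w, hw, hs⟩
  have : CompactSpace (stdSimplex ℝ ι) := isCompact_iff_compactSpace.1 (isCompact_stdSimplex ℝ ι)
  rw [h]
  refine isClosedMap_snd_of_compactSpace _ (isClosed_singleton.preimage ?_)
  exact continuous_finsetSum _ fun i _ =>
    ((continuous_apply i).comp (continuous_subtype_val.comp continuous_fst)).smul
      ((hf i).comp continuous_snd)

variable {d n : ℕ}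

lemma continuous_partialSum (k : ℕ) :
    Continuous fun x : Fin n → EuclideanSpace ℝ (Fin d) => partialSum x k :=
  continuous_finsetSum _ fun i _ => continuous_apply i

lemma hullPoints_eq_range (T : WalkType) (hn : 0 < n) : ∃ (ι : Type) (_ : Fintype ι)
    (f : ι → (Fin n → EuclideanSpace ℝ (Fin d)) → EuclideanSpace ℝ (Fin d)),
    (∀ i, Continuous (f i)) ∧ ∀ x, hullPoints T x = Set.range fun i => f i x := by
  have hB : ∀ x : Fin n → EuclideanSpace ℝ (Fin d), {y | ∃ k, 1 ≤ k ∧ k ≤ n ∧ y = partialSum x k} =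
      Set.range fun i : Fin n => partialSum x (i + 1) := by
    intro x
    ext y
    constructor
    · rintro ⟨k, h1, h2, rfl⟩
      exact ⟨⟨k - 1, by omega⟩, by simp [Nat.sub_add_cancel h1]⟩
    · rintro ⟨k, rfl⟩
      exact ⟨k + 1, by omega, by omega, rfl⟩
  cases T with
  | A =>
    refine ⟨Fin (n - 1), inferInstance, fun i x => partialSum x (i + 1),
      fun i => continuous_partialSum _, fun x => ?_⟩
    ext y
    constructor
    · rintro ⟨k, h1, h2, rfl⟩
      exact ⟨⟨k - 1, by omega⟩, by simp [Nat.sub_add_cancel h1]⟩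
    · rintro ⟨k, rfl⟩
      exact ⟨k + 1, by omega, by omega, rfl⟩
  | B =>
    exact ⟨Fin n, inferInstance, fun i x => partialSum x (i + 1),
      fun i => continuous_partialSum _, hB⟩
  | D =>
    refine ⟨Fin n ⊕ Unit, inferInstance,
      Sum.elim (fun i x => partialSum x (i + 1))
        (fun _ x => partialSum x (n - 1) - x ⟨n - 1, by omega⟩), ?_, fun x => ?_⟩
    · rintro (i | i)
      · exact continuous_partialSum _
      · exact (continuous_partialSum _).sub (continuous_apply _)
    · have hrange : (Set.range fun i => (Sum.elim (fun (i : Fin n) x => partialSum x (i + 1))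
          (fun (_ : Unit) x => partialSum x (n - 1) - x ⟨n - 1, by omega⟩) i :
            (Fin n → EuclideanSpace ℝ (Fin d)) → EuclideanSpace ℝ (Fin d)) x) =
          (Set.range fun i : Fin n => partialSum x (i + 1)) ∪
            {partialSum x (n - 1) - x ⟨n - 1, by omega⟩} := by
        ext y
        simp [eq_comm, or_comm]
      rw [hrange, hullPoints, hB]
      congr 1
      ext y
      constructor
      · rintro ⟨i, hi, rfl⟩
        have h : i = ⟨n - 1, by omega⟩ := Fin.ext (by simp; omega)
        rw [h]
        rfl
      · rintro rfl
        exact ⟨⟨n - 1, by omega⟩, by simp; omega, rfl⟩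

lemma measurableSet_setOf_zero_notMem_convexHull (T : WalkType) (hn : 0 < n) :
    MeasurableSet {x : Fin n → EuclideanSpace ℝ (Fin d) |
      (0 : EuclideanSpace ℝ (Fin d)) ∉ convexHull ℝ (hullPoints T x)} := by
  obtain ⟨ι, _, f, hf, hfx⟩ := hullPoints_eq_range (d := d) T hn
  have h := (isClosed_setOf_zero_mem_convexHull_range f hf).measurableSet.compl
  simp only [hfx]
  exact h

end measurability

/-! ### The type `D` hull -/

section typeD

variable {E : Type*} [AddCommGroup E] {m : ℕ}

lemma partialSum_congr {n : ℕ} {x y : Fin n → E} {k : ℕ} (h : ∀ i : Fin n, (i : ℕ) < k → x i = y i) :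
    partialSum x k = partialSum y k :=
  Finset.sum_congr rfl fun i hi => h i (Finset.mem_filter.1 hi).2

lemma partialSum_succ_self (x : Fin (m + 1) → E) :
    partialSum x (m + 1) = partialSum x m + x (Fin.last m) := by
  have h1 : partialSum x (m + 1) = ∑ i, x i := by
    rw [partialSum, Finset.filter_true_of_mem fun i _ => i.isLt]
  have h2 : partialSum x m = ∑ i : Fin m, x i.castSucc := by
    rw [partialSum, Finset.sum_filter, Fin.sum_univ_castSucc]
    simp
  rw [h1, h2, Fin.sum_univ_castSucc]

lemma hullPoints_D_eq (x : Fin (m + 1) → E) :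
    hullPoints .D x = {y | ∃ k, 1 ≤ k ∧ k ≤ m ∧ y = partialSum x k} ∪
      {partialSum x m + x (Fin.last m), partialSum x m - x (Fin.last m)} := by
  rw [← partialSum_succ_self]
  ext y
  constructor
  · rintro (⟨k, h1, h2, rfl⟩ | ⟨i, hi, rfl⟩)
    · rcases Nat.lt_or_ge m k with h | h
      · obtain rfl : k = m + 1 := by omega
        exact .inr (.inl rfl)
      · exact .inl ⟨k, h1, h, rfl⟩
    · obtain rfl : i = Fin.last m := Fin.ext (by simpa using hi)
      exact .inr (.inr rfl)
  · rintro (⟨k, h1, h2, rfl⟩ | rfl | rfl)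
    · exact .inl ⟨k, h1, by omega, rfl⟩
    · exact .inl ⟨m + 1, by omega, le_rfl, rfl⟩
    · exact .inr ⟨Fin.last m, rfl, rfl⟩

/-- The type `D` hull does not change when the sign of the last increment does. -/
lemma hullPoints_D_congr {x y : Fin (m + 1) → E} (h : ∀ i, i ≠ Fin.last m → x i = y i)
    (hlast : x (Fin.last m) = -y (Fin.last m)) : hullPoints .D x = hullPoints .D y := by
  have hk : ∀ k ≤ m, partialSum x k = partialSum y k := fun k hk =>
    partialSum_congr fun i hi => h i fun h' => by
      rw [h', Fin.val_last] at hi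
      omega
  rw [hullPoints_D_eq, hullPoints_D_eq, hlast, hk m le_rfl, sub_neg_eq_add, ← sub_eq_add_neg,
    Set.pair_comm]
  congr 1
  ext z
  exact exists_congr fun k => and_congr_right fun _ => and_congr_right fun h => by rw [hk k h]

lemma hullPoints_B_subset_D {n : ℕ} (x : Fin n → E) : hullPoints .B x ⊆ hullPoints .D x :=
  Set.subset_union_left

end typeD

/-! ### Averaging over the group -/

/-- Double counting: both sides compare with the expected number of `g` for which `Y g` falls in
`U`. -/
lemma card_mul_measureReal_le {Ω X G : Type*} [MeasurableSpace Ω] [MeasurableSpace X] [Fintype G]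
    (P : Measure Ω) [IsProbabilityMeasure P] (U : Set X) (Y : G → Ω → X)
    (hY : ∀ g, MeasurableSet (Y g ⁻¹' U)) (p : ℝ) (hp : ∀ g, P.real (Y g ⁻¹' U) = p) (B : ℝ)
    (hB : ∀ᵐ ω ∂P, ((∑ g, indicatorNat (Y g ω ∈ U) : ℕ) : ℝ) ≤ B) :
    Fintype.card G * p ≤ B := by
  have hind : ∀ (g : G) (ω : Ω),
      (indicatorNat (Y g ω ∈ U) : ℝ) = (Y g ⁻¹' U).indicator (fun _ => (1 : ℝ)) ω := by
    intro g ω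
    by_cases h : Y g ω ∈ U
    · rw [indicatorNat_of_true h, Set.indicator_of_mem (by exact h), Nat.cast_one]
    · rw [indicatorNat_of_false h, Set.indicator_of_notMem (by exact h), Nat.cast_zero]
  have hint : ∀ g, Integrable ((Y g ⁻¹' U).indicator fun _ => (1 : ℝ)) P := fun g =>
    (integrable_const 1).indicator (hY g)
  calc (Fintype.card G : ℝ) * p = ∑ g, ∫ ω, (Y g ⁻¹' U).indicator (fun _ => (1 : ℝ)) ω ∂P := by
        simp [integral_indicator_const, hY, hp]
    _ = ∫ ω, ∑ g, (Y g ⁻¹' U).indicator (fun _ => (1 : ℝ)) ω ∂P :=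
        (integral_finsetSum _ fun g _ => hint g).symm
    _ ≤ ∫ _, B ∂P := by
        refine integral_mono_ae (integrable_finsetSum _ fun g _ => hint g) (integrable_const B) ?_
        filter_upwards [hB] with ω hω
        simpa only [Nat.cast_sum, hind] using hω
    _ = B := by simp

/-! ### The bound on the product -/

lemma pow_mul_prod_le_rpow {ε u : ℝ} (hε : 0 < ε) (hε1 : ε < 1 / 2) (hu : 1 / 2 ≤ u) (hu1 : u ≤ 1)
    {n d : ℕ} (hn : Real.exp ((d : ℝ) / (u - ε)) < n) :
    ((1 - ε / 2)⁻¹) ^ d * ∏ k ∈ Finset.range n, (1 - u * (ε / 2) / ((k : ℝ) + 1)) ≤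
      (n : ℝ) ^ (-(ε ^ 2 / 4)) := by
  have hn0 : (0 : ℝ) < n := (Real.exp_pos _).trans hn
  have hd : (d : ℝ) ≤ (u - ε) * Real.log n := by
    have := (Real.lt_log_iff_exp_lt hn0).2 hn
    rw [div_lt_iff₀ (by linarith)] at this
    linarith
  have hL : 0 ≤ Real.log n := by
    by_contra h
    have : (0 : ℝ) ≤ d := Nat.cast_nonneg d
    nlinarith
  set t := ε / 2 with ht
  have hs : 0 < 1 - t := by linarith
  have h1 : (1 - t)⁻¹ ^ d ≤ Real.exp (d * (t / (1 - t))) := by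
    rw [Real.exp_nat_mul]
    refine pow_le_pow_left₀ (by positivity) ?_ d
    have := Real.add_one_le_exp (t / (1 - t))
    have h2 : t / (1 - t) + 1 = (1 - t)⁻¹ := by field_simp; ring
    rwa [h2] at this
  have h2 : ∏ k ∈ Finset.range n, (1 - u * t / ((k : ℝ) + 1)) ≤
      Real.exp (-(u * t) * Real.log n) := by
    calc ∏ k ∈ Finset.range n, (1 - u * t / ((k : ℝ) + 1))
        ≤ ∏ k ∈ Finset.range n, Real.exp (-(u * t) * ((k : ℝ) + 1)⁻¹) := by
          refine Finset.prod_le_prod (fun k _ => ?_) fun k _ => ?_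
          · have hk : (0 : ℝ) ≤ k := Nat.cast_nonneg k
            rw [sub_nonneg, div_le_one (by positivity)]
            nlinarith
          · have := Real.add_one_le_exp (-(u * t) * ((k : ℝ) + 1)⁻¹)
            rw [div_eq_mul_inv]
            linarith
      _ = Real.exp (-(u * t) * (harmonic n : ℝ)) := by
          rw [← Real.exp_sum, ← Finset.mul_sum]
          simp [harmonic]
      _ ≤ Real.exp (-(u * t) * Real.log n) := by
          rw [Real.exp_le_exp]
          have h3 := log_add_one_le_harmonic n
          have h4 : Real.log n ≤ Real.log ((n + 1 : ℕ) : ℝ) :=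
            Real.log_le_log hn0 (by push_cast; linarith)
          have : 0 ≤ u * t := by positivity
          nlinarith
  have h0 : 0 ≤ ∏ k ∈ Finset.range n, (1 - u * t / ((k : ℝ) + 1)) := by
    refine Finset.prod_nonneg fun k _ => ?_
    have hk : (0 : ℝ) ≤ k := Nat.cast_nonneg k
    rw [sub_nonneg, div_le_one (by positivity)]
    nlinarith
  refine (mul_le_mul h1 h2 h0 (Real.exp_pos _).le).trans ?_
  rw [← Real.exp_add, Real.rpow_def_of_pos hn0, Real.exp_le_exp]
  have h3 : (d : ℝ) * (t / (1 - t)) ≤ (u - ε) * Real.log n * (t / (1 - t)) :=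
    mul_le_mul_of_nonneg_right hd (by positivity)
  -- Since `ε = 2t`, the bracket in `h5` equals `t (u - 1) - t²`, which is nonpositive as `u ≤ 1`.
  have h4 : (u - ε) * (t / (1 - t)) - u * t ≤ -(ε ^ 2 / 4) := by
    have h5 : (u - ε) * (t / (1 - t)) - u * t + ε ^ 2 / 4 =
        t * ((u - ε) - u * (1 - t) + t * (1 - t)) / (1 - t) := by
      field_simp
      rw [ht]
      ring
    have h6 : t * ((u - ε) - u * (1 - t) + t * (1 - t)) / (1 - t) ≤ 0 := by
      refine div_nonpos_of_nonpos_of_nonneg (mul_nonpos_of_nonneg_of_nonpos (by positivity) ?_) hs.le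
      have : 0 ≤ t := by positivity
      nlinarith
    linarith
  nlinarith

/-! ### Probability bounds -/

section probability

variable {Ω : Type*} [MeasurableSpace Ω] {P : Measure Ω} {n d : ℕ}
  {ξ : Fin n → Ω → EuclideanSpace ℝ (Fin d)}

lemma measurable_signedRearrange (hξ : ∀ i, Measurable (ξ i))
    (g : Equiv.Perm (Fin n) × (Fin n → ℤˣ)) :
    Measurable fun ω => signedRearrange (fun i => ξ i ω) g :=
  measurable_pi_lambda _ fun i => (hξ (g.1 i)).const_smul (((g.2 i : ℤ) : ℝ))

lemma InvariantUnder.measureReal_eq {σ : Equiv.Perm (Fin n)} {ε : Fin n → ℤˣ}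
    (h : InvariantUnder P ξ σ ε) {U : Set (Fin n → EuclideanSpace ℝ (Fin d))}
    (hU : MeasurableSet U) :
    P.real ((fun ω => signedRearrange (fun i => ξ i ω) (σ, ε)) ⁻¹' U) =
      P.real ((fun ω i => ξ i ω) ⁻¹' U) := by
  rw [measureReal_def, measureReal_def, h.measure_mem_eq hU]
  rfl

lemma card_signedPerm (n : ℕ) : (Fintype.card (Equiv.Perm (Fin n) × (Fin n → ℤˣ)) : ℝ) =
    ∏ k ∈ Finset.range n, (2 * ((k : ℝ) + 1)) := by
  rw [Finset.prod_mul_distrib, Fintype.card_prod, Fintype.card_perm, Fintype.card_fin,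
    ← Finset.prod_range_add_one_eq_factorial]
  simp only [Fintype.card_pi, Fintype.card_units_int, Finset.prod_const, Finset.card_univ,
    Fintype.card_fin, Finset.card_range]
  push_cast
  ring

/-- An odd sign change becomes even after one more flip at the last index, and that flip leaves the
hull unchanged. -/
lemma IsWalkOfType.measureReal_invariant_D (hn : 0 < n) (h : IsWalkOfType P ξ .D)
    (g : Equiv.Perm (Fin n) × (Fin n → ℤˣ)) :
    P.real ((fun ω => signedRearrange (fun i => ξ i ω) g) ⁻¹'
        {x | (0 : EuclideanSpace ℝ (Fin d)) ∉ convexHull ℝ (hullPoints .D x)}) =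
      P.real {ω | (0 : EuclideanSpace ℝ (Fin d)) ∉ convexHull ℝ (hullPoints .D fun i => ξ i ω)} := by
  obtain ⟨σ, ε⟩ := g
  have hU := measurableSet_setOf_zero_notMem_convexHull (d := d) .D hn
  rcases Int.units_eq_one_or (∏ i, ε i) with hε | hε
  · exact (h σ ε hε).measureReal_eq hU
  · obtain ⟨m, rfl⟩ : ∃ m, n = m + 1 := ⟨n - 1, by omega⟩
    have hflip : ∏ i, (ε * Pi.mulSingle (Fin.last m) (-1) : Fin (m + 1) → ℤˣ) i = 1 := by
      simp only [Pi.mul_apply, Finset.prod_mul_distrib, hε]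
      simp
    refine Eq.trans ?_ ((h σ _ hflip).measureReal_eq hU)
    congr 1
    ext ω
    simp only [Set.mem_preimage, Set.mem_ofPred_eq]
    rw [hullPoints_D_congr]
    · intro i hi
      simp [signedRearrange, hi]
    · simp [signedRearrange]

variable [IsProbabilityMeasure P]

/-- If the type `T` hull contains the type `B` hull and the probability that it misses `0` is the
same for all signed rearrangements, then this probability obeys the type `B` bound. -/
lemma measureReal_zero_notMem_convexHull_le {T : WalkType} (hn : 0 < n)
    (hξ : ∀ i, Measurable (ξ i))
    (hT : ∀ y : Fin n → EuclideanSpace ℝ (Fin d), hullPoints .B y ⊆ hullPoints T y)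
    (hinv : ∀ g, P.real ((fun ω => signedRearrange (fun i => ξ i ω) g) ⁻¹'
        {x | (0 : EuclideanSpace ℝ (Fin d)) ∉ convexHull ℝ (hullPoints T x)}) =
      P.real {ω | (0 : EuclideanSpace ℝ (Fin d)) ∉ convexHull ℝ (hullPoints T fun i => ξ i ω)})
    {s : ℝ} (hs : 0 < s) (hs1 : s ≤ 1) :
    P.real {ω | (0 : EuclideanSpace ℝ (Fin d)) ∉ convexHull ℝ (hullPoints T fun i => ξ i ω)} ≤
      s⁻¹ ^ d * ∏ k ∈ Finset.range n, (1 - 1 / 2 * (1 - s) / ((k : ℝ) + 1)) := by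
  have h := card_mul_measureReal_le P
    {x | (0 : EuclideanSpace ℝ (Fin d)) ∉ convexHull ℝ (hullPoints T x)}
    (fun g ω => signedRearrange (fun i => ξ i ω) g)
    (fun g => measurable_signedRearrange hξ g (measurableSet_setOf_zero_notMem_convexHull T hn))
    _ hinv (s⁻¹ ^ d * ∏ k ∈ Finset.range n, (2 * (k : ℝ) + 1 + s)) (.of_forall fun ω => ?_)
  · have hprod : ∏ k ∈ Finset.range n, (2 * (k : ℝ) + 1 + s) =
        (∏ k ∈ Finset.range n, (2 * ((k : ℝ) + 1))) *
          ∏ k ∈ Finset.range n, (1 - 1 / 2 * (1 - s) / ((k : ℝ) + 1)) := by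
      rw [← Finset.prod_mul_distrib]
      refine Finset.prod_congr rfl fun k _ => ?_
      field_simp
      ring
    rw [card_signedPerm, hprod, mul_left_comm] at h
    exact le_of_mul_le_mul_left h (Finset.prod_pos fun k _ => by positivity)
  · have hle := badCountB_le hs hs1 fun i => ξ i ω
    rw [finrank_euclideanSpace_fin] at hle
    refine le_trans (Nat.cast_le.2 (Finset.sum_le_sum fun g _ => ?_)) hle
    by_cases hg : HasChamberRelB (signedRearrange (fun i => ξ i ω) g)
    · rw [indicatorNat_of_false]
      · exact Nat.zero_le _
      · exact not_not.2 (convexHull_mono (hT _) hg.zero_mem_convexHull)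
    · rw [indicatorNat_of_true hg]
      exact indicatorNat_le_one _

lemma IsWalkOfType.measureReal_le_A (hn : 0 < n) (hξ : ∀ i, Measurable (ξ i))
    (h : IsWalkOfType P ξ .A) {s : ℝ} (hs : 0 < s) (hs1 : s ≤ 1) :
    P.real {ω | (0 : EuclideanSpace ℝ (Fin d)) ∉ convexHull ℝ (hullPoints .A fun i => ξ i ω)} ≤
      s⁻¹ ^ (d + 1) * ∏ k ∈ Finset.range n, (1 - 1 * (1 - s) / ((k : ℝ) + 1)) := by
  have hU := measurableSet_setOf_zero_notMem_convexHull (d := d) .A hn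
  have hone : ∀ (x : Fin n → EuclideanSpace ℝ (Fin d)) (σ : Equiv.Perm (Fin n)),
      signedRearrange x (σ, 1) = x ∘ σ := fun x σ => by
    ext i
    simp [signedRearrange]
  have h := card_mul_measureReal_le P
    {x | (0 : EuclideanSpace ℝ (Fin d)) ∉ convexHull ℝ (hullPoints .A x)}
    (fun (σ : Equiv.Perm (Fin n)) ω => signedRearrange (fun i => ξ i ω) (σ, 1))
    (fun σ => measurable_signedRearrange hξ (σ, 1) hU)
    _ (fun σ => (h.1 σ).measureReal_eq hU)
    (s⁻¹ ^ (d + 1) * ∏ k ∈ Finset.range n, ((k : ℝ) + s)) ?_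
  · have hprod : ∏ k ∈ Finset.range n, ((k : ℝ) + s) =
        (∏ k ∈ Finset.range n, ((k : ℝ) + 1)) *
          ∏ k ∈ Finset.range n, (1 - 1 * (1 - s) / ((k : ℝ) + 1)) := by
      rw [← Finset.prod_mul_distrib]
      refine Finset.prod_congr rfl fun k _ => ?_
      field_simp
      ring
    have hcard : (Fintype.card (Equiv.Perm (Fin n)) : ℝ) = ∏ k ∈ Finset.range n, ((k : ℝ) + 1) := by
      rw [Fintype.card_perm, Fintype.card_fin, ← Finset.prod_range_add_one_eq_factorial]
      push_cast
      rfl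
    rw [hcard, hprod, mul_left_comm] at h
    exact le_of_mul_le_mul_left h (Finset.prod_pos fun k _ => by positivity)
  · filter_upwards [h.2] with ω hω
    have hle := badCountA_le hs hs1 fun i => ξ i ω
    rw [finrank_euclideanSpace_fin] at hle
    refine le_trans (Nat.cast_le.2 (Finset.sum_le_sum fun σ _ => ?_)) hle
    rw [hone]
    by_cases hg : HasChamberRelA ((fun i => ξ i ω) ∘ σ)
    · have hsum : partialSum ((fun i => ξ i ω) ∘ σ) n = 0 := by
        have htot : ∀ y : Fin n → EuclideanSpace ℝ (Fin d), partialSum y n = ∑ i, y i := fun y => by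
          rw [partialSum, Finset.filter_true_of_mem fun i _ => i.isLt]
        rw [htot] at hω ⊢
        rw [← hω]
        exact Equiv.sum_comp σ fun i => ξ i ω
      rw [indicatorNat_of_false]
      · exact Nat.zero_le _
      · exact not_not.2 (hg.zero_mem_convexHull hsum)
    · rw [indicatorNat_of_true hg]
      exact indicatorNat_le_one _

end probability

/-! ### The theorem -/

theorem theorem5p5 :
    ∀ ε : ℝ, 0 < ε → ε < 1 / 2 →
      ∃ δ C : ℝ, 0 < δ ∧ δ < 1 ∧ 0 < C ∧
        ∀ (T : WalkType) (n d : ℕ), 1 ≤ d → Real.exp ((d : ℝ) / (T.u - ε)) < (n : ℝ) →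
        ∀ (Ω : Type*) [MeasurableSpace Ω] (P : Measure Ω) [IsProbabilityMeasure P]
          (ξ : Fin n → Ω → EuclideanSpace ℝ (Fin d)),
          (∀ i, Measurable (ξ i)) → IsWalkOfType P ξ T →
          1 - C * (n : ℝ) ^ (-δ) ≤
            P.real {ω | (0 : EuclideanSpace ℝ (Fin d)) ∈
              convexHull ℝ (hullPoints T (fun i => ξ i ω))} := by
  intro ε hε hε1
  -- The exponent comes from `s = 1 - ε / 2`; the constant 2 bounds the additional `s⁻¹` of type A.
  refine ⟨ε ^ 2 / 4, 2, by positivity, by nlinarith, two_pos, ?_⟩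
  intro T n d _ hnd Ω _ P _ ξ hξ hT
  have hn0 : (0 : ℝ) < n := (Real.exp_pos _).trans hnd
  have hn : 0 < n := Nat.cast_pos.1 hn0
  have hs : 0 < 1 - ε / 2 := by linarith
  have hs1 : 1 - ε / 2 ≤ 1 := by linarith
  have hR : 0 < (n : ℝ) ^ (-(ε ^ 2 / 4)) := Real.rpow_pos_of_pos hn0 _
  suffices hbad : P.real {ω | (0 : EuclideanSpace ℝ (Fin d)) ∉
      convexHull ℝ (hullPoints T fun i => ξ i ω)} ≤ 2 * (n : ℝ) ^ (-(ε ^ 2 / 4)) by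
    have hmeas : MeasurableSet {ω | (0 : EuclideanSpace ℝ (Fin d)) ∉
        convexHull ℝ (hullPoints T fun i => ξ i ω)} :=
      measurable_pi_lambda (fun ω i => ξ i ω) hξ (measurableSet_setOf_zero_notMem_convexHull T hn)
    have hcompl := probReal_compl_eq_one_sub (μ := P) hmeas
    have hset : {ω | (0 : EuclideanSpace ℝ (Fin d)) ∉
        convexHull ℝ (hullPoints T fun i => ξ i ω)}ᶜ = {ω | (0 : EuclideanSpace ℝ (Fin d)) ∈
        convexHull ℝ (hullPoints T fun i => ξ i ω)} := by
      ext ω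
      exact not_not
    rw [hset] at hcompl
    linarith
  have hsub : 1 - (1 - ε / 2) = ε / 2 := by ring
  cases T with
  | A =>
    have h1 := hT.measureReal_le_A hn hξ hs hs1
    have h2 := pow_mul_prod_le_rpow hε hε1 (by norm_num) le_rfl hnd
    rw [hsub, pow_succ', mul_assoc] at h1
    refine h1.trans (mul_le_mul ?_ h2 ?_ two_pos.le)
    · rw [inv_le_comm₀ hs two_pos]
      linarith
    · refine mul_nonneg (by positivity) (Finset.prod_nonneg fun k _ => ?_)
      rw [sub_nonneg, div_le_one (by positivity)]
      have : (0 : ℝ) ≤ k := Nat.cast_nonneg k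
      linarith
  | B =>
    have h1 := measureReal_zero_notMem_convexHull_le (P := P) (T := .B) hn hξ (fun y => subset_rfl)
      (fun g => (hT g.1 g.2).measureReal_eq (measurableSet_setOf_zero_notMem_convexHull .B hn))
      hs hs1
    have h2 := pow_mul_prod_le_rpow hε hε1 le_rfl (by norm_num) hnd
    rw [hsub] at h1
    linarith
  | D =>
    have h1 := measureReal_zero_notMem_convexHull_le (P := P) (T := .D) hn hξ hullPoints_B_subset_D
      (hT.measureReal_invariant_D hn) hs hs1
    have h2 := pow_mul_prod_le_rpow hε hε1 le_rfl (by norm_num) hnd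
    rw [hsub] at h1
    linarith
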